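/- A hypergraph $H=(V,E)$ consists of disjoint finite sets $V\neq\emptyset$ (vertices) and $E$ (edges) together with an incidence function $\psi:E\to 2^V$; we write $v\in e$ for $v\in\psi(e)$ (distinct edges $e\ne f$ with $\psi(e)=\psi(f)$ are allowed). The degree of $v$ is the number of edges $e\in E$ with $v\in e$, and the cardinality of $e$ is $|\psi(e)|$. A walk is a sequence $W=v_0e_1v_1e_2v_2\ldots e_kv_k$ ($k\ge 0$) with $v_i\in V$, $e_i\in E$, such that $v_{i-1}\ne v_i$ and $v_{i-1},v_i\in e_i$ for $i=1,\dots,k$. A vertex or edge lies on $W$ if it is one of the terms of this sequence. The walk $W$ is a pseudo cycle if $k\ge 2$, $v_0=v_k$, the flags $(v_0,e_1),(v_1,e_1),(v_1,e_2),\ldots,(v_{k-1},e_k),(v_k,e_k)$ are pairwise distinct, and the vertices $v_0,\ldots,v_{k-1}$ are pairwise distinct (the edges need not be distinct). $H$ is connected if any two distinct vertices are joined by a walk. A hypersubgraph of $H$ is a hypergraph $(V',E')$ with $\emptyset\ne V'\subseteq V$, $E'\subseteq E$ and $\psi(e)\subseteq V'$ for all $e\in E'$, with incidence function $\psi|_{E'}$.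 A vertex $v$ is a separating vertex of the connected hypergraph $H$ if there are connected hypersubgraphs $H_1=(V_1,E_1)$ and $H_2=(V_2,E_2)$ of $H$ with $E_1\neq\emptyset\neq E_2$, $V_1\cup V_2=V$, $E_1\cup E_2=E$, $E_1\cap E_2=\emptyset$ and $V_1\cap V_2=\{v\}$. Let $H=(V,E)$ be a connected hypergraph with $|E|\ge 2$, without edges of cardinality less than $2$, and without vertices of degree less than $2$. Then the following are equivalent: 1. $H$ has no separating vertices. 2. Every pair of distinct elements of $V\cup E$ lie on a common pseudo cycle. 3. Every pair of distinct edges lie on a common pseudo cycle. 4. Every pair of distinct vertices lie on a common pseudo cycle. -/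

import Mathlib

/-- A hypergraph with vertex set `V` and edge set `E`, given by its incidence function
`ψ : E → 2^V`. Unlike for Mathlib's `Hypergraph`, whose hyperedges form a set of sets, distinct
parallel edges are allowed. Finiteness of `V` and `E` and non-emptiness of `V` are imposed where
hypergraphs are quantified over. -/
structure MultiHypergraph (V : Type*) (E : Type*) where
  /-- The incidence function. -/
  inc : E → Set V

namespace MultiHypergraph

section Basic

variable {V : Type*} {E : Type*}

/-- The degree of a vertex: the number of edges incident with it. -/
noncomputable def degree (H : MultiHypergraph V E) (v : V) : ℕ :=
  {e : E | v ∈ H.inc e}.ncard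

/-- The cardinality of an edge. -/
noncomputable def edgeCard (H : MultiHypergraph V E) (e : E) : ℕ :=
  (H.inc e).ncard

/-- The vertices `u` and `v` are adjacent via the edge `e`; adjacent vertices are distinct. -/
def AdjVia (H : MultiHypergraph V E) (e : E) (u v : V) : Prop :=
  u ≠ v ∧ u ∈ H.inc e ∧ v ∈ H.inc e

/-- A walk `v₀ e₁ v₁ e₂ … eₖ vₖ`, with consecutive anchor vertices adjacent via the edge
between them. -/
inductive Walk (H : MultiHypergraph V E) : V → V → Type _
  | nil (u : V) : Walk H u u
  | cons {u v w : V} (e : E) (h : H.AdjVia e u v) (p : Walk H v w) : Walk H u w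

namespace Walk

/-- The length `k` of a walk `v₀ e₁ v₁ … eₖ vₖ`. -/
def length {H : MultiHypergraph V E} {u v : V} : H.Walk u v → ℕ
  | nil _ => 0
  | cons _ _ p => p.length + 1

/-- The list `v₀, v₁, …, vₖ` of anchors of a walk. -/
def anchors {H : MultiHypergraph V E} {u v : V} : H.Walk u v → List V
  | nil u => [u]
  | cons (u := u) _ _ p => u :: p.anchors

/-- The list `e₁, …, eₖ` of edges of a walk. -/
def edges {H : MultiHypergraph V E} {u v : V} : H.Walk u v → List E
  | nil _ => []
  | cons e _ p => e :: p.edges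

/-- The list `(v₀, e₁), (v₁, e₁), (v₁, e₂), …, (vₖ₋₁, eₖ), (vₖ, eₖ)` of anchor flags of a
walk. -/
def anchorFlags {H : MultiHypergraph V E} {u v : V} : H.Walk u v → List (V × E)
  | nil _ => []
  | cons (u := u) (v := v) e _ p => (u, e) :: (v, e) :: p.anchorFlags

/-- A trail is a walk whose anchor flags are pairwise distinct. -/
def IsTrail {H : MultiHypergraph V E} {u v : V} (p : H.Walk u v) : Prop :=
  p.anchorFlags.Nodup

/-- A pseudo cycle is a closed walk (of length `k ≥ 2`, with `v₀ = vₖ`) that is a trail and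
whose vertices `v₀, …, vₖ₋₁` are pairwise distinct; its edges may repeat. -/
def IsPseudoCycle {H : MultiHypergraph V E} {u : V} (p : H.Walk u u) : Prop :=
  2 ≤ p.length ∧ p.IsTrail ∧ p.anchors.dropLast.Nodup

/-- An element of the disjoint union of `V` and `E` lies on a walk if it is one of the terms of
the sequence `v₀ e₁ v₁ … eₖ vₖ`. -/
def Contains {H : MultiHypergraph V E} {u v : V} (p : H.Walk u v) : V ⊕ E → Prop
  | Sum.inl x => x ∈ p.anchors
  | Sum.inr e => e ∈ p.edges

end Walk

/-- A hypergraph is connected if any two distinct vertices are joined by a walk. -/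
def Connected (H : MultiHypergraph V E) : Prop :=
  ∀ u v : V, u ≠ v → Nonempty (H.Walk u v)

/-- A hypersubgraph: a non-empty set of vertices and a set of edges all of whose vertices
belong to that set (so edges are not truncated). -/
structure Hypersubgraph (H : MultiHypergraph V E) where
  /-- The vertex set of the hypersubgraph. -/
  verts : Set V
  /-- The edge set of the hypersubgraph. -/
  edges : Set E
  verts_nonempty : verts.Nonempty
  inc_subset : ∀ e ∈ edges, H.inc e ⊆ verts

/-- A hypersubgraph as a hypergraph in its own right. -/
def Hypersubgraph.coe {H : MultiHypergraph V E} (K : H.Hypersubgraph) :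
    MultiHypergraph K.verts K.edges where
  inc e := {v : K.verts | (v : V) ∈ H.inc (e : E)}

/-- `H = H₁ ⊕ H₂`: the hypergraph `H` is the union of its hypersubgraphs `H₁` and `H₂`, which
have no edge in common. -/
def Decomposes (H : MultiHypergraph V E) (H₁ H₂ : H.Hypersubgraph) : Prop :=
  H₁.verts ∪ H₂.verts = Set.univ ∧ H₁.edges ∪ H₂.edges = Set.univ ∧
    H₁.edges ∩ H₂.edges = ∅

/-- A separating vertex: `H` decomposes into two connected hypersubgraphs, each with at least
one edge, that have just the vertex `v` in common. -/
def IsSeparatingVertex (H : MultiHypergraph V E) (v : V) : Prop :=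
  ∃ H₁ H₂ : H.Hypersubgraph, H.Decomposes H₁ H₂ ∧
    H₁.edges.Nonempty ∧ H₂.edges.Nonempty ∧
    H₁.coe.Connected ∧ H₂.coe.Connected ∧
    H₁.verts ∩ H₂.verts = {v}

/-- Two elements of the disjoint union of `V` and `E` lie on a common pseudo cycle. -/
def OnCommonPseudoCycle (H : MultiHypergraph V E) (x y : V ⊕ E) : Prop :=
  ∃ (u : V) (p : H.Walk u u), p.IsPseudoCycle ∧ p.Contains x ∧ p.Contains y

end Basic

end MultiHypergraph

/-! A nontrivial closed trail of the incidence graph `levi` that passes through each vertex of `V`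
at most once gives a pseudo cycle; nodes of `E` may be revisited. Lying on a common such trail
(`Linked`) is transitive when the middle element is an edge: `IsSlim.exists_splice` follows the
second trail both ways from the new element until it meets the first, and closes up along an arc of
the first.

If `v` is not separating, any two edges at `v` are joined in `levi` by a path avoiding `v`
(`exists_levi_walk_avoiding`), so they lie on a cycle through `v`. Chaining along walks links all
edges, and degree at least two links each vertex to an edge.

Conversely, a pseudo cycle cannot cross a separating vertex and come back, since it would pass there
twice (`IsPseudoCycle.edges_subset_or`). Elements chosen on opposite sides then refute 3 and 4. -/

open scoped Classical in
/-- The number of occurrences on a walk of edges incident with a vertex. -/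
noncomputable def SimpleGraph.Walk.visits {W : Type*} {G : SimpleGraph W} {a b : W}
    (p : G.Walk a b) (x : W) : ℕ :=
  p.edges.countP fun e => x ∈ e

/-! ### Counting the edges of a walk at a vertex -/

namespace SimpleGraph.Walk

section Visits

variable {W : Type*} {G : SimpleGraph W}

theorem visits_append {a b c : W} (p : G.Walk a b) (q : G.Walk b c) (x : W) :
    (p.append q).visits x = p.visits x + q.visits x := by
  simp [visits, List.countP_append]

theorem visits_reverse {a b : W} (p : G.Walk a b) (x : W) :
    p.reverse.visits x = p.visits x := by
  simp [visits]

theorem visits_rotate [DecidableEq W] {a b : W} (p : G.Walk a a) (h : b ∈ p.support) (x : W) :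
    (p.rotate b h).visits x = p.visits x :=
  (p.rotate_edges b h).perm.countP_eq _

theorem mem_support_rotate [DecidableEq W] {a b x : W} (p : G.Walk a a) (h : b ∈ p.support) :
    x ∈ (p.rotate b h).support ↔ x ∈ p.support := by
  conv_rhs => rw [← p.take_spec h]
  simp only [rotate, mem_support_append_iff]
  exact or_comm

open scoped Classical in
theorem visits_cons {a b c : W} (h : G.Adj a b) (p : G.Walk b c) (x : W) :
    (cons h p).visits x = p.visits x + if x = a ∨ x = b then 1 else 0 := by
  simp [visits, List.countP_cons]

theorem visits_eq_zero {a b x : W} (p : G.Walk a b) (hx : x ∉ p.support) : p.visits x = 0 := by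
  rw [visits, List.countP_eq_zero]
  intro e he hxe
  exact hx (p.mem_support_of_mem_edges he (by simpa using hxe))

theorem visits_start_pos {a b : W} (p : G.Walk a b) (hp : ¬ p.Nil) : 0 < p.visits a := by
  cases p with
  | nil => simp at hp
  | cons h p => simp [visits_cons]

/-- Euler's parity argument. Together with a bound of two visits it forces exactly one. -/
theorem IsTrail.odd_visits {a b x : W} {p : G.Walk a b} (hp : p.IsTrail) (hab : a ≠ b)
    (hx : x = a ∨ x = b) : p.visits x % 2 = 1 := by
  classical
  have h := hp.even_countP_edges_iff x
  have h' : ¬ Even (p.edges.countP fun e => x ∈ e) := by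
    rw [h]; tauto
  rw [← Nat.odd_iff, ← Nat.not_even_iff_odd]
  convert h' using 2
  unfold visits
  congr!

open scoped Classical in
/-- The visits of a path to a vertex are at most two, and at most one at its start. -/
theorem IsPath.visits_le {a b : W} {p : G.Walk a b} (hp : p.IsPath) (x : W) :
    p.visits x + (if x = a then 1 else 0) ≤ 2 := by
  induction p with
  | nil => simp [visits]; split_ifs <;> omega
  | @cons a c b h p ih =>
    rw [cons_isPath_iff] at hp
    have := ih hp.1
    have h2 : x = a → p.visits x = 0 := fun hx => visits_eq_zero p (hx ▸ hp.2)
    have h3 := h.ne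
    rw [visits_cons]
    by_cases h4 : x = a <;> by_cases h5 : x = c <;> simp_all

/-- Any walk meeting a set splits at its first vertex in that set. -/
theorem exists_append_of_mem (S : Set W) {a b : W} (p : G.Walk a b)
    (h : ∃ x ∈ p.support, x ∈ S) :
    ∃ (c : W) (q : G.Walk a c) (r : G.Walk c b), p = q.append r ∧ c ∈ S ∧
      ∀ x ∈ q.support, x ∈ S → x = c := by
  induction p with
  | @nil a =>
    obtain ⟨x, hx, hxS⟩ := h
    obtain rfl : x = a := by simpa using hx
    exact ⟨x, nil, nil, rfl, hxS, by simp⟩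
  | @cons a d b hd p ih =>
    by_cases ha : a ∈ S
    · exact ⟨a, nil, cons hd p, rfl, ha, by simp⟩
    · obtain ⟨c, q, r, rfl, hc, hq⟩ := ih (by
        obtain ⟨x, hx, hxS⟩ := h
        rw [support_cons, List.mem_cons] at hx
        rcases hx with rfl | hx
        · exact absurd hxS ha
        · exact ⟨x, hx, hxS⟩)
      refine ⟨c, cons hd q, r, rfl, hc, ?_⟩
      intro x hx hxS
      rw [support_cons, List.mem_cons] at hx
      rcases hx with rfl | hx
      · exact absurd hxS ha
      · exact hq x hx hxS

/-- Any two vertices `a`, `b` of a closed trail are the ends of a subtrail through any third. -/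
theorem IsTrail.exists_arc {o : W} {p : G.Walk o o} (hp : p.IsTrail) {a b x : W}
    (ha : a ∈ p.support) (hb : b ∈ p.support) (hx : x ∈ p.support) :
    ∃ q : G.Walk a b, q.IsTrail ∧ q.edges ⊆ p.edges ∧ x ∈ q.support ∧
      ∀ y, q.visits y ≤ p.visits y := by
  classical
  have hb' : b ∈ (p.rotate a ha).support := (mem_support_rotate p ha).2 hb
  have hspec := (p.rotate a ha).take_spec hb'
  set q := (p.rotate a ha).takeUntil b hb'
  set r := (p.rotate a ha).dropUntil b hb'
  have htr : (q.append r).IsTrail := by rw [hspec]; exact hp.rotate ha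
  have hed : (q.append r).edges ⊆ p.edges := by
    rw [hspec]; exact (p.rotate_edges a ha).perm.subset
  have hvis : ∀ y, q.visits y + r.visits y = p.visits y := fun y => by
    rw [← visits_append, hspec, visits_rotate]
  have hx' : x ∈ (q.append r).support := by rw [hspec]; exact (mem_support_rotate p ha).2 hx
  rw [edges_append] at hed
  rw [mem_support_append_iff] at hx'
  -- The two ends cut the closed trail into two arcs; take the one through `x`, reversing it if
  -- necessary.
  rcases hx' with hx' | hx'
  · exact ⟨q, htr.of_append_left, (List.append_subset.1 hed).1, hx',
      fun y => by have := hvis y; omega⟩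
  · refine ⟨r.reverse, htr.of_append_right.reverse, ?_, by simpa using hx',
      fun y => by have := hvis y; rw [visits_reverse]; omega⟩
    intro e he
    exact (List.append_subset.1 hed).2 (by simpa using he)

/-- An edge inside `S` would have both its ends equal to `c`. This keeps the arcs outside a trail
edge-disjoint from it. -/
theorem exists_mem_notMem_of_mem_edges {S : Set W} {a b c : W} {q : G.Walk a b}
    (hq : ∀ x ∈ q.support, x ∈ S → x = c) {e : Sym2 W} (he : e ∈ q.edges) :
    ∃ x ∈ e, x ∉ S := by
  induction e with
  | h u v =>
    by_contra! h
    have hu := hq u (q.fst_mem_support_of_mem_edges he) (h u (by simp))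
    have hv := hq v (q.snd_mem_support_of_mem_edges he) (h v (by simp))
    exact (q.adj_of_mem_edges he).ne (hu.trans hv.symm)

end Visits

/-! ### Splicing closed trails -/

section Slim

variable {W : Type*} {G : SimpleGraph W} {P : Set W}

/-- A trail using at most two edges at each vertex of `P`. A closed trail of this kind passes
through each vertex of `P` at most once. -/
def IsSlim (P : Set W) {a b : W} (p : G.Walk a b) : Prop :=
  p.IsTrail ∧ ∀ v ∈ P, p.visits v ≤ 2

/-- Two closed slim trails sharing a vertex outside `P` can be spliced. -/
theorem IsSlim.exists_splice {o o' : W} {p : G.Walk o o} {q : G.Walk o' o'}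
    (hp : p.IsSlim P) (hq : q.IsSlim P) {x e z : W} (he : e ∉ P) (hep : e ∈ p.support)
    (heq : e ∈ q.support) (hx : x ∈ p.support) (hz : z ∈ q.support) :
    ∃ (c : W) (r : G.Walk c c), r.IsSlim P ∧ x ∈ r.support ∧ z ∈ r.support := by
  classical
  set S : Set W := {y | y ∈ p.support}
  by_cases hzp : z ∈ S
  · exact ⟨o, p, hp, hx, hzp⟩
  -- the closed trail `q`, started at `z`, and its first and last vertices on `p`
  obtain ⟨a, q₁, s, hqs, haS, hq₁⟩ := exists_append_of_mem S (q.rotate z hz)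
    ⟨e, (mem_support_rotate q hz).2 heq, hep⟩
  obtain ⟨b, q₂, t, hst, hbS, hq₂⟩ := exists_append_of_mem S s.reverse
    ⟨a, by simp, haS⟩
  have htr : (q₁.append s).IsTrail := hqs ▸ hq.1.rotate hz
  have hvis : ∀ y, q₁.visits y + q₂.visits y + t.visits y = q.visits y := fun y => by
    rw [← visits_rotate q hz, hqs, visits_append, ← visits_reverse s, hst, visits_append]
    omega
  have hed : (q₁.edges ++ (q₂.edges ++ t.edges)).Nodup := by
    have h1 := htr.edges_nodup
    have h2 : s.edges.Perm (q₂.edges ++ t.edges) := by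
      rw [← edges_append, ← hst, edges_reverse]; exact (List.reverse_perm _).symm
    rw [edges_append] at h1
    exact ((List.Perm.append_left _ h2).nodup_iff).1 h1
  have hq₁t : q₁.IsTrail := htr.of_append_left
  have hst' : (q₂.append t).IsTrail := hst ▸ htr.of_append_right.reverse
  have hq₂t : q₂.IsTrail := hst'.of_append_left
  have hza : z ≠ a := fun h => hzp (h ▸ haS)
  have hzb : z ≠ b := fun h => hzp (h ▸ hbS)
  have h1 := hq₁t.odd_visits hza (.inr rfl)
  have h2 := hq₂t.odd_visits hzb (.inr rfl)
  -- If `a = b` were in `P`, then `q₁` and `q₂` would exhaust the two edges of `q` there, so `t` is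
  -- trivial. Then `e` lies on `q₁` or `q₂` and on `p`, so it equals `a`, contrary to `e ∉ P`.
  have hab : a = b → a ∉ P := by
    rintro rfl haP
    have h3 := hq.2 a haP
    rw [← hvis] at h3
    have ht : t.Nil := by
      by_contra ht
      have := t.visits_start_pos ht
      omega
    have hes : e ∈ (q₁.append s).support := hqs ▸ (mem_support_rotate q hz).2 heq
    rw [mem_support_append_iff, ← List.mem_reverse (as := s.support), ← support_reverse, hst,
      mem_support_append_iff, nil_iff_support_eq.1 ht] at hes
    have : e = a := by
      rcases hes with h | h | h
      · exact hq₁ e h hep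
      · exact hq₂ e h hep
      · simpa using h
    exact he (this ▸ haP)
  obtain ⟨r, hrt, hrp, hxr, hrv⟩ := hp.1.exists_arc haS hbS hx
  refine ⟨a, r.append (q₂.reverse.append q₁), ⟨?_, ?_⟩, ?_, ?_⟩
  · rw [isTrail_def, edges_append, edges_append, edges_reverse]
    have hout : ∀ f ∈ q₂.edges.reverse ++ q₁.edges, ∃ y ∈ f, y ∉ S := by
      intro f hf
      rw [List.mem_append, List.mem_reverse] at hf
      rcases hf with hf | hf
      · exact exists_mem_notMem_of_mem_edges hq₂ hf
      · exact exists_mem_notMem_of_mem_edges hq₁ hf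
    refine List.nodup_append'.2 ⟨hrt.edges_nodup, ?_, ?_⟩
    · rw [← List.append_assoc, List.nodup_append'] at hed
      exact ((List.perm_append_comm.trans
        (List.Perm.append_right _ (List.reverse_perm _).symm)).nodup_iff).1 hed.1
    · intro f hf hf'
      obtain ⟨y, hy, hyS⟩ := hout f hf'
      exact hyS (p.mem_support_of_mem_edges (hrp hf) hy)
  · intro v hv
    rw [visits_append, visits_append, visits_reverse]
    have h3 := hvis v
    have h4 := hq.2 v hv
    have h5 := hp.2 v hv
    have h6 := hrv v
    -- On `p`, the outer arcs reach only `a` and `b`. At such an end in `P`, one outer arc and `r`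
    -- each have an odd number of visits, at most two, hence one each.
    by_cases hvS : v ∈ S
    · by_cases hva : v = a
      · subst hva
        have hvb : v ≠ b := fun h => hab h hv
        have h7 := hrt.odd_visits hvb (.inl rfl)
        have h8 : q₂.visits v = 0 := visits_eq_zero _ fun h => hvb (hq₂ v h hvS)
        omega
      · have h8 : q₁.visits v = 0 := visits_eq_zero _ fun h => hva (hq₁ v h hvS)
        by_cases hvb : v = b
        · subst hvb
          have h7 := hrt.odd_visits (Ne.symm hva) (.inr rfl)
          omega
        · have h9 : q₂.visits v = 0 := visits_eq_zero _ fun h => hvb (hq₂ v h hvS)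
          omega
    · have h7 : p.visits v = 0 := visits_eq_zero p hvS
      omega
  · rw [mem_support_append_iff]; exact .inl hxr
  · simp only [mem_support_append_iff]; exact .inr (.inr (start_mem_support _))

end Slim

end SimpleGraph.Walk

/-! ### Closed trails of the incidence graph as pseudo cycles -/

namespace MultiHypergraph

section Levi

variable {V : Type*} {E : Type*} {H : MultiHypergraph V E}

theorem Walk.anchors_eq_cons {u w : V} (q : H.Walk u w) : q.anchors = u :: q.anchors.tail := by
  cases q <;> rfl

theorem Walk.anchors_eq_concat {u w : V} (q : H.Walk u w) :
    q.anchors = q.anchors.dropLast ++ [w] := by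
  induction q with
  | nil u => rfl
  | cons e h p ih =>
    have h1 := p.anchors_eq_cons
    rw [anchors, h1, List.dropLast_cons_cons, List.cons_append, ← h1, ← ih]

theorem Walk.start_mem_anchors {u w : V} (q : H.Walk u w) : u ∈ q.anchors := by
  rw [q.anchors_eq_cons]; simp

theorem Walk.count_dropLast_anchors [DecidableEq V] {u : V} (q : H.Walk u u) (v : V) :
    q.anchors.dropLast.count v = q.anchors.tail.count v := by
  have h : (q.anchors.dropLast ++ [u]).count v = (u :: q.anchors.tail).count v := by
    rw [← q.anchors_eq_cons, ← q.anchors_eq_concat]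
  simpa [List.count_append, List.count_cons] using h

/-- Each step contributes one flag at its start and one at its end. -/
theorem Walk.countP_anchorFlags [DecidableEq V] {u w : V} (q : H.Walk u w) (v : V) :
    q.anchorFlags.countP (fun a => v = a.1) =
      q.anchors.dropLast.count v + q.anchors.tail.count v := by
  induction q with
  | nil u => simp [anchorFlags, anchors]
  | cons e h p ih =>
    have h1 := p.anchors_eq_cons
    rw [anchors, h1, List.dropLast_cons_cons, ← h1]
    simp only [anchorFlags, List.countP_cons, List.count_cons, List.tail_cons, ih]
    conv_rhs => rw [h1]
    simp only [List.count_cons, beq_iff_eq, decide_eq_true_eq, eq_comm (a := v)]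
    rw [← h1]
    omega

theorem Walk.two_le_length {u : V} {q : H.Walk u u} (hq : q.edges ≠ []) : 2 ≤ q.length := by
  cases q with
  | nil => exact absurd rfl hq
  | cons e h p =>
    cases p with
    | nil => exact absurd rfl h.1
    | cons => simp [length]

theorem Walk.mem_anchors_of_edges_eq_nil {u w x : V} {q : H.Walk u w} (hq : q.edges = [])
    (hx : x ∈ q.anchors) : x = u := by
  cases q with
  | nil => simpa [anchors] using hx
  | cons => simp [edges] at hq

/-- The incidence graph of a hypergraph. -/
def levi (H : MultiHypergraph V E) : SimpleGraph (V ⊕ E) where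
  Adj
    | .inl v, .inr e => v ∈ H.inc e
    | .inr e, .inl v => v ∈ H.inc e
    | _, _ => False
  symm := ⟨by rintro (v | e) (w | f) h <;> exact h⟩
  loopless := ⟨by rintro (v | e) h <;> exact h⟩

theorem levi_adj {v : V} {e : E} : H.levi.Adj (.inl v) (.inr e) ↔ v ∈ H.inc e := Iff.rfl

theorem levi_adj' {v : V} {e : E} : H.levi.Adj (.inr e) (.inl v) ↔ v ∈ H.inc e := Iff.rfl

/-- Two steps of the incidence graph make one step of the hypergraph, hence strong induction on the
length. Graph edges correspond to flags, so distinctness transfers. -/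
theorem exists_walk_of_levi_walk (n : ℕ) : ∀ {u w : V} (p : H.levi.Walk (.inl u) (.inl w)),
    p.length ≤ n → p.IsTrail →
    ∃ q : H.Walk u w, q.anchorFlags.map (fun a => s(Sum.inl a.1, Sum.inr a.2)) = p.edges ∧
      ∀ x ∈ p.support, q.Contains x := by
  induction n using Nat.strong_induction_on with
  | _ n ih =>
    intro u w p hn hp
    cases p with
    | nil => exact ⟨.nil u, rfl, by simp [Walk.Contains, Walk.anchors]⟩
    | @cons _ x _ h p =>
      rcases x with x | e
      · exact h.elim
      cases p with
      | @cons _ x _ h' p =>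
        rcases x with v | f
        swap
        · exact h'.elim
        simp only [SimpleGraph.Walk.length_cons] at hn
        -- Going back to `u` at once would use the same graph edge twice.
        have huv : u ≠ v := by
          rintro rfl
          simp [SimpleGraph.Walk.isTrail_def, Sym2.eq_swap] at hp
        obtain ⟨q, hq, hc⟩ := ih (n - 2) (by omega) p (by omega) hp.of_cons.of_cons
        refine ⟨.cons e ⟨huv, h, h'⟩ q, ?_, ?_⟩
        · simp [Walk.anchorFlags, hq, Sym2.eq_swap]
        · intro x hx
          simp only [SimpleGraph.Walk.support_cons, List.mem_cons] at hx
          rcases hx with rfl | rfl | hx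
          · simp [Walk.Contains, Walk.anchors]
          · simp [Walk.Contains, Walk.edges]
          · have := hc x hx
            rcases x with x | x
            · exact List.mem_cons_of_mem _ this
            · exact List.mem_cons_of_mem _ this

/-- Two elements of `V ⊕ E` lie on a common closed trail of the incidence graph that passes
through each vertex of the hypergraph at most once. -/
def Linked (H : MultiHypergraph V E) (x y : V ⊕ E) : Prop :=
  ∃ (o : V ⊕ E) (p : H.levi.Walk o o), p.IsSlim (Set.range Sum.inl) ∧
    x ∈ p.support ∧ y ∈ p.support

theorem Linked.refl (x : V ⊕ E) : H.Linked x x :=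
  ⟨x, .nil, ⟨by simp, by simp [SimpleGraph.Walk.visits]⟩, by simp, by simp⟩

theorem Linked.symm {x y : V ⊕ E} (h : H.Linked x y) : H.Linked y x := by
  obtain ⟨o, p, hp, hx, hy⟩ := h
  exact ⟨o, p, hp, hy, hx⟩

/-- The middle element must be an edge, since splicing needs a common node that may be revisited. -/
theorem Linked.trans {x z : V ⊕ E} {e : E} (h : H.Linked x (.inr e)) (h' : H.Linked (.inr e) z) :
    H.Linked x z := by
  obtain ⟨o, p, hp, hx, he⟩ := h
  obtain ⟨o', q, hq, he', hz⟩ := h'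
  exact hp.exists_splice hq (by simp) he he' hx hz

theorem Linked.onCommonPseudoCycle {x y : V ⊕ E} (h : H.Linked x y) (hxy : x ≠ y) :
    H.OnCommonPseudoCycle x y := by
  classical
  obtain ⟨o, p, hp, hx, hy⟩ := h
  obtain ⟨u, hu⟩ : ∃ u, Sum.inl u ∈ p.support := by
    rcases o with u | e
    · exact ⟨u, p.start_mem_support⟩
    · cases p with
      | nil => simp_all
      | @cons _ w _ h p =>
        rcases w with w | f
        · exact ⟨w, by simp⟩
        · exact h.elim
  obtain ⟨q, hq, hc⟩ := exists_walk_of_levi_walk _ (p.rotate _ hu) le_rfl (hp.1.rotate hu)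
  have hcx := hc x ((SimpleGraph.Walk.mem_support_rotate p hu).2 hx)
  have hcy := hc y ((SimpleGraph.Walk.mem_support_rotate p hu).2 hy)
  refine ⟨u, q, ⟨Walk.two_le_length ?_, ?_, ?_⟩, hcx, hcy⟩
  · intro h0
    rcases x with x | x <;> rcases y with y | y <;> simp only [Walk.Contains, h0] at hcx hcy
    · exact hxy (by rw [Walk.mem_anchors_of_edges_eq_nil h0 hcx,
        Walk.mem_anchors_of_edges_eq_nil h0 hcy])
    all_goals simp_all
  · have := (hp.1.rotate hu).edges_nodup
    rw [← hq] at this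
    exact this.of_map
  -- In a closed walk each occurrence of `v` among the anchors, the last one omitted, accounts for
  -- two flags, and slimness allows at most two.
  · rw [List.nodup_iff_count_le_one]
    intro v
    have h1 := hp.2 (.inl v) ⟨v, rfl⟩
    rw [← SimpleGraph.Walk.visits_rotate p hu, SimpleGraph.Walk.visits, ← hq,
      List.countP_map] at h1
    have h2 := q.countP_anchorFlags v
    have h3 := q.count_dropLast_anchors v
    have h4 : q.anchorFlags.countP (fun a => v = a.1) ≤ 2 := by
      convert h1 using 2
      ext a
      simp
    omega

end Levi

/-! ### Linking in the absence of separating vertices -/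

section Separating

variable {V : Type*} {E : Type*} {H : MultiHypergraph V E}

theorem Walk.trans {u v w : V} (p : H.Walk u v) (q : H.Walk v w) : Nonempty (H.Walk u w) := by
  induction p with
  | nil => exact ⟨q⟩
  | cons e h p ih =>
    obtain ⟨r⟩ := ih q
    exact ⟨.cons e h r⟩

theorem Walk.symm {u v : V} (p : H.Walk u v) : Nonempty (H.Walk v u) := by
  induction p with
  | nil u => exact ⟨.nil u⟩
  | cons e h p ih =>
    obtain ⟨r⟩ := ih
    exact r.trans (.cons e ⟨h.1.symm, h.2.2, h.2.1⟩ (.nil _))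

/-- A hypersubgraph attached to the rest of a connected hypergraph at one vertex is connected. -/
theorem Hypersubgraph.coe_connected (hconn : H.Connected) (K : H.Hypersubgraph) {v : V}
    (hv : v ∈ K.verts) (hK : ∀ e, ∀ x ∈ H.inc e, x ∈ K.verts → x ≠ v → e ∈ K.edges) :
    K.coe.Connected := by
  have key : ∀ {u w : V} (_ : H.Walk u w) (hu : u ∈ K.verts), w = v →
      Nonempty (K.coe.Walk ⟨u, hu⟩ ⟨v, hv⟩) := by
    intro u w p
    induction p with
    | nil u =>
      rintro hu rfl
      exact ⟨.nil _⟩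
    | @cons u x w e h p ih =>
      intro hu hw
      by_cases huv : u = v
      · subst huv
        exact ⟨.nil _⟩
      · have he := hK e u h.2.1 hu huv
        have hx := K.inc_subset e he h.2.2
        obtain ⟨q⟩ := ih hx hw
        exact ⟨.cons ⟨e, he⟩ ⟨fun h' => h.1 (congrArg Subtype.val h'), h.2.1, h.2.2⟩ q⟩
  have key' : ∀ u : K.verts, Nonempty (K.coe.Walk u ⟨v, hv⟩) := by
    rintro ⟨u, hu⟩
    by_cases huv : u = v
    · subst huv
      exact ⟨.nil _⟩
    · obtain ⟨p⟩ := hconn u v huv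
      exact key p hu rfl
  intro a b _
  obtain ⟨p⟩ := key' a
  obtain ⟨q⟩ := key' b
  obtain ⟨q'⟩ := q.symm
  exact p.trans q'

/-- Otherwise the part `S` reachable from `e` without `v`, and its complement, each taken together
with `v`, form a decomposition that makes `v` separating. -/
theorem exists_levi_walk_avoiding (hconn : H.Connected) {v : V} (hv : ¬ H.IsSeparatingVertex v)
    (e f : E) : ∃ p : H.levi.Walk (.inr e) (.inr f), Sum.inl v ∉ p.support := by
  by_contra hef
  set S : Set (V ⊕ E) := {x | ∃ p : H.levi.Walk (.inr e) x, Sum.inl v ∉ p.support}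
  have hS : ∀ {x y}, x ∈ S → H.levi.Adj x y → y ≠ .inl v → y ∈ S := by
    rintro x y ⟨p, hp⟩ h hy
    exact ⟨p.concat h, by simp [SimpleGraph.Walk.support_concat, hp, hy.symm]⟩
  have heS : Sum.inr e ∈ S := ⟨.nil, by simp⟩
  have hvS : Sum.inl v ∉ S := fun ⟨p, hp⟩ => hp p.end_mem_support
  let H₁ : H.Hypersubgraph :=
    { verts := {x | x = v ∨ Sum.inl x ∈ S}
      edges := {g | Sum.inr g ∈ S}
      verts_nonempty := ⟨v, .inl rfl⟩
      inc_subset := fun g hg x hx => by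
        by_cases hxv : x = v
        · exact .inl hxv
        · exact .inr (hS hg (levi_adj'.2 hx) (by simpa using hxv)) }
  let H₂ : H.Hypersubgraph :=
    { verts := {x | Sum.inl x ∉ S}
      edges := {g | Sum.inr g ∉ S}
      verts_nonempty := ⟨v, hvS⟩
      inc_subset := fun g hg x hx hxS => hg (hS hxS (levi_adj.2 hx) (by simp)) }
  refine hv ⟨H₁, H₂, ⟨?_, ?_, ?_⟩, ⟨e, heS⟩, ⟨f, hef⟩,
    H₁.coe_connected hconn (v := v) (.inl rfl) ?_,
    H₂.coe_connected hconn (v := v) hvS ?_, ?_⟩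
  · ext x
    simp only [Set.mem_union, Set.mem_univ, iff_true, H₁, H₂, Set.mem_ofPred_eq]
    tauto
  · ext x
    simp only [Set.mem_union, Set.mem_univ, iff_true, H₁, H₂, Set.mem_ofPred_eq]
    tauto
  · ext x
    simp only [Set.mem_inter_iff, Set.mem_empty_iff_false, iff_false, H₁, H₂, Set.mem_ofPred_eq]
    tauto
  · intro g x hx hxK hxv
    exact hS (hxK.resolve_left hxv) (levi_adj.2 hx) (by simp)
  · intro g x hx hxK hxv hg
    exact hxK (hS hg (levi_adj'.2 hx) (by simpa using hxv))
  · ext x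
    simp only [Set.mem_inter_iff, Set.mem_singleton_iff, H₁, H₂, Set.mem_ofPred_eq]
    constructor
    · tauto
    · rintro rfl
      exact ⟨.inl rfl, hvS⟩

/-- Two edges at a vertex that is not separating lie, with that vertex, on a closed trail. -/
theorem exists_slim_of_mem_inc (hconn : H.Connected) {v : V} (hv : ¬ H.IsSeparatingVertex v)
    {e f : E} (hef : e ≠ f) (he : v ∈ H.inc e) (hf : v ∈ H.inc f) :
    ∃ p : H.levi.Walk (.inl v) (.inl v), p.IsSlim (Set.range Sum.inl) ∧
      Sum.inr e ∈ p.support ∧ Sum.inr f ∈ p.support := by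
  classical
  obtain ⟨p, hp⟩ := exists_levi_walk_avoiding hconn hv e f
  have hq := p.bypass_isPath
  have hvq : Sum.inl v ∉ p.bypass.support := fun h => hp (p.support_bypass_subset_support h)
  set q := p.bypass
  -- The path from `e` to `f` avoiding `v`, closed up through `v`, is the required trail.
  have hr : (q.concat (levi_adj'.2 hf)).IsPath := hq.concat hvq _
  refine ⟨.cons (levi_adj.2 he) (q.concat (levi_adj'.2 hf)), ⟨?_, ?_⟩, by simp, ?_⟩
  · rw [SimpleGraph.Walk.isTrail_cons]
    refine ⟨hr.isTrail, ?_⟩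
    rw [SimpleGraph.Walk.edges_concat]
    simp only [List.concat_eq_append, List.mem_append, List.mem_singleton, not_or]
    refine ⟨fun h => hvq (q.fst_mem_support_of_mem_edges h), ?_⟩
    simp [hef]
  · rintro _ ⟨x, rfl⟩
    rw [SimpleGraph.Walk.visits_cons]
    have h1 := hq.visits_le (.inl x)
    rw [SimpleGraph.Walk.concat_eq_append, SimpleGraph.Walk.visits_append,
      SimpleGraph.Walk.visits_cons]
    by_cases hx : x = v
    · subst hx
      rw [SimpleGraph.Walk.visits_eq_zero q hvq]
      simp [SimpleGraph.Walk.visits]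
    · simpa [hx, SimpleGraph.Walk.visits] using h1
  · simp [SimpleGraph.Walk.support_concat]

theorem linked_inr_inr (hconn : H.Connected) (hsep : ¬ ∃ v, H.IsSeparatingVertex v) {u w : V}
    (p : H.Walk u w) : ∀ {e f : E}, u ∈ H.inc e → w ∈ H.inc f →
      H.Linked (.inr e) (.inr f) := by
  have adj : ∀ {v : V} {e f : E}, v ∈ H.inc e → v ∈ H.inc f → H.Linked (.inr e) (.inr f) := by
    intro v e f he hf
    by_cases hef : e = f
    · exact hef ▸ .refl _
    · obtain ⟨p, hp, h⟩ := exists_slim_of_mem_inc hconn (fun h => hsep ⟨v, h⟩) hef he hf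
      exact ⟨_, p, hp, h⟩
  induction p with
  | nil u => exact adj
  | cons g h p ih => exact fun he hf => (adj he h.2.1).trans (ih h.2.2 hf)

theorem linked_of_not_separating (hconn : H.Connected) (hsize : ∀ e : E, 2 ≤ H.edgeCard e)
    (hdeg : ∀ v : V, 2 ≤ H.degree v) (hsep : ¬ ∃ v, H.IsSeparatingVertex v) (x y : V ⊕ E) :
    H.Linked x y := by
  have edge : ∀ e f : E, H.Linked (.inr e) (.inr f) := by
    intro e f
    obtain ⟨u, hu⟩ : (H.inc e).Nonempty := Set.nonempty_of_ncard_ne_zero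
      (by have := hsize e; unfold edgeCard at this; omega)
    obtain ⟨w, hw⟩ : (H.inc f).Nonempty := Set.nonempty_of_ncard_ne_zero
      (by have := hsize f; unfold edgeCard at this; omega)
    by_cases huw : u = w
    · exact linked_inr_inr hconn hsep (.nil u) hu (huw ▸ hw)
    · obtain ⟨p⟩ := hconn u w huw
      exact linked_inr_inr hconn hsep p hu hw
  -- Transitivity works only through edges, so vertices are first linked to an edge, using two edges
  -- at the vertex.
  have flag : ∀ x : V ⊕ E, ∃ e : E, H.Linked x (.inr e) := by
    rintro (v | e)
    · obtain ⟨e, he, f, hf, hef⟩ := (Set.one_lt_ncard_iff_nontrivial_and_finite.1 (hdeg v)).1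
      obtain ⟨p, hp, hpe, -⟩ :=
        exists_slim_of_mem_inc hconn (fun h => hsep ⟨v, h⟩) hef he hf
      exact ⟨e, _, p, hp, p.start_mem_support, hpe⟩
    · exact ⟨e, .refl _⟩
  obtain ⟨e, he⟩ := flag x
  obtain ⟨f, hf⟩ := flag y
  exact (he.trans (edge e f)).trans hf.symm

/-! ### Walks relative to one side of a separating vertex -/

section Sides

variable {v : V} {A : Set V} {B : Set E}

/-- A walk that ends in `A` and meets `v` at most at its start uses only edges of `B`, when edges
of `B` lie in `A` and the other edges meet `A` at most in `v`. -/
theorem Walk.edges_subset_of_end_mem (hBA : ∀ e ∈ B, H.inc e ⊆ A)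
    (hAB : ∀ e, ∀ x ∈ H.inc e, x ∈ A → x ≠ v → e ∈ B) {u w : V} (p : H.Walk u w)
    (hw : w ∈ A) (hv : v ∉ p.anchors.tail) : u ∈ A ∧ ∀ e ∈ p.edges, e ∈ B := by
  induction p with
  | nil u => exact ⟨hw, by simp [edges]⟩
  | cons e h p ih =>
    simp only [anchors, List.tail_cons] at hv
    obtain ⟨hA, hB⟩ := ih hw (fun h => hv (List.mem_of_mem_tail h))
    have he := hAB e _ h.2.2 hA (fun h => hv (h ▸ p.start_mem_anchors))
    refine ⟨hBA e he h.2.1, ?_⟩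
    simpa [edges, he] using hB

theorem Walk.edges_subset_of_start_mem (hBA : ∀ e ∈ B, H.inc e ⊆ A)
    (hAB : ∀ e, ∀ x ∈ H.inc e, x ∈ A → x ≠ v → e ∈ B) {u w : V} (p : H.Walk u w)
    (hu : u ∈ A) (hv : v ∉ p.anchors.dropLast) : ∀ e ∈ p.edges, e ∈ B := by
  induction p with
  | nil u => simp [edges]
  | cons e h p ih =>
    rw [anchors, p.anchors_eq_cons, List.dropLast_cons_cons, ← p.anchors_eq_cons, List.mem_cons,
      not_or] at hv
    have he := hAB e _ h.2.1 hu (Ne.symm hv.1)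
    simpa [edges, he] using ih (hBA e he h.2.2) hv.2

/-- Before reaching `v` the walk cannot leave `A`; from `v` on it never returns to `v`, so it must
already be on the side where it ends. -/
theorem Walk.edges_subset_of_nodup (hBA : ∀ e ∈ B, H.inc e ⊆ A)
    (hAB : ∀ e, ∀ x ∈ H.inc e, x ∈ A → x ≠ v → e ∈ B) {u w : V} (p : H.Walk u w)
    (hu : u ∈ A) (hw : w ∈ A) (hwv : w ≠ v) (hp : p.anchors.dropLast.Nodup) :
    ∀ e ∈ p.edges, e ∈ B := by
  induction p with
  | nil u => simp [edges]
  | @cons u x w e h p ih =>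
    rw [anchors, p.anchors_eq_cons, List.dropLast_cons_cons, ← p.anchors_eq_cons,
      List.nodup_cons] at hp
    by_cases huv : u = v
    · subst huv
      refine ((cons e h p).edges_subset_of_end_mem hBA hAB hw ?_).2
      rw [anchors, List.tail_cons, p.anchors_eq_concat]
      simpa [hp.1] using hwv.symm
    · have he := hAB e _ h.2.1 hu huv
      simpa [edges, he] using ih (hBA e he h.2.2) hw hwv hp.2

theorem Walk.exists_mem_edges_of_mem_anchors {u w x : V} (p : H.Walk u w) (hp : p.edges ≠ [])
    (hx : x ∈ p.anchors) : ∃ e ∈ p.edges, x ∈ H.inc e := by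
  induction p with
  | nil u => exact absurd rfl hp
  | cons e h p ih =>
    simp only [anchors, List.mem_cons] at hx
    simp only [edges, List.mem_cons, exists_eq_or_imp]
    rcases hx with rfl | hx
    · exact .inl h.2.1
    · by_cases hp' : p.edges = []
      · exact .inl (mem_anchors_of_edges_eq_nil hp' hx ▸ h.2.2)
      · exact .inr (ih hp' hx)

end Sides

/-! ### Separating vertices obstruct common pseudo cycles -/

variable {v : V} {H₁ H₂ : H.Hypersubgraph}

theorem Decomposes.symm (hd : H.Decomposes H₁ H₂) : H.Decomposes H₂ H₁ :=
  ⟨Set.union_comm _ _ ▸ hd.1, Set.union_comm _ _ ▸ hd.2.1, Set.inter_comm _ _ ▸ hd.2.2⟩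

theorem Decomposes.mem_edges (hd : H.Decomposes H₁ H₂) (hv : H₁.verts ∩ H₂.verts = {v}) (e : E)
    (x : V) (hx : x ∈ H.inc e) (hx₁ : x ∈ H₁.verts) (hxv : x ≠ v) : e ∈ H₁.edges := by
  have he : e ∈ H₁.edges ∪ H₂.edges := hd.2.1 ▸ Set.mem_univ e
  refine he.resolve_right fun he => hxv ?_
  have : x ∈ H₁.verts ∩ H₂.verts := ⟨hx₁, H₂.inc_subset e he hx⟩
  rwa [hv] at this

/-- A pseudo cycle stays on one side of a separating vertex. -/
theorem Walk.IsPseudoCycle.edges_subset_or (hd : H.Decomposes H₁ H₂)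
    (hv : H₁.verts ∩ H₂.verts = {v}) {u : V} {p : H.Walk u u} (hp : p.IsPseudoCycle) :
    (∀ e ∈ p.edges, e ∈ H₁.edges) ∨ ∀ e ∈ p.edges, e ∈ H₂.edges := by
  have h₁ := hd.mem_edges hv
  have h₂ := hd.symm.mem_edges (Set.inter_comm _ _ ▸ hv)
  have hV : ∀ x, x ∈ H₁.verts ∪ H₂.verts := fun x => hd.1 ▸ Set.mem_univ x
  have hnd := hp.2.2
  -- Based at `v`, the second anchor decides the side, as `v` recurs only at the end; otherwise the
  -- base point decides.
  by_cases huv : u = v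
  · subst huv
    cases p with
    | nil => simp [edges]
    | @cons _ x _ e h p =>
      rw [anchors, p.anchors_eq_cons, List.dropLast_cons_cons, ← p.anchors_eq_cons,
        List.nodup_cons] at hnd
      simp only [edges, List.forall_mem_cons]
      rcases hV x with hx | hx
      · exact .inl ⟨h₁ e x h.2.2 hx h.1.symm,
          p.edges_subset_of_start_mem H₁.inc_subset h₁ hx hnd.1⟩
      · exact .inr ⟨h₂ e x h.2.2 hx h.1.symm,
          p.edges_subset_of_start_mem H₂.inc_subset h₂ hx hnd.1⟩
  · rcases hV u with hu | hu
    · exact .inl (p.edges_subset_of_nodup H₁.inc_subset h₁ hu hu huv hnd)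
    · exact .inr (p.edges_subset_of_nodup H₂.inc_subset h₂ hu hu huv hnd)

theorem IsSeparatingVertex.exists_edges (h : H.IsSeparatingVertex v) :
    ∃ e f : E, e ≠ f ∧ ¬ H.OnCommonPseudoCycle (.inr e) (.inr f) := by
  obtain ⟨H₁, H₂, hd, ⟨e, he⟩, ⟨f, hf⟩, -, -, hv⟩ := h
  have hdis : ∀ g, g ∈ H₁.edges → g ∉ H₂.edges := fun g h₁ h₂ => by
    have : g ∈ H₁.edges ∩ H₂.edges := ⟨h₁, h₂⟩
    rw [hd.2.2] at this
    exact this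
  refine ⟨e, f, fun h => hdis e he (h ▸ hf), ?_⟩
  rintro ⟨u, p, hp, hpe, hpf⟩
  rcases hp.edges_subset_or hd hv with h | h
  · exact hdis f (h f hpf) hf
  · exact hdis e he (h e hpe)

/-- Edges of cardinality at least two supply a vertex other than `v` on each side. -/
theorem IsSeparatingVertex.exists_verts (hsize : ∀ e : E, 2 ≤ H.edgeCard e)
    (h : H.IsSeparatingVertex v) :
    ∃ u w : V, u ≠ w ∧ ¬ H.OnCommonPseudoCycle (.inl u) (.inl w) := by
  obtain ⟨H₁, H₂, hd, ⟨e, he⟩, ⟨f, hf⟩, -, -, hv⟩ := h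
  obtain ⟨u, hu, huv⟩ := Set.exists_ne_of_one_lt_ncard (hsize e) v
  obtain ⟨w, hw, hwv⟩ := Set.exists_ne_of_one_lt_ncard (hsize f) v
  have hu₁ := H₁.inc_subset e he hu
  have hw₂ := H₂.inc_subset f hf hw
  have hdis : ∀ x, x ∈ H₁.verts → x ∈ H₂.verts → x = v := fun x h₁ h₂ => by
    have : x ∈ H₁.verts ∩ H₂.verts := ⟨h₁, h₂⟩
    rwa [hv] at this
  refine ⟨u, w, fun h => huv (hdis u hu₁ (h ▸ hw₂)), ?_⟩
  rintro ⟨o, p, hp, hpu, hpw⟩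
  have hne : p.edges ≠ [] := by
    cases p with
    | nil => exact absurd hp.1 (by simp [Walk.length])
    | cons => simp [Walk.edges]
  rcases hp.edges_subset_or hd hv with h | h
  · obtain ⟨g, hg, hwg⟩ := p.exists_mem_edges_of_mem_anchors hne hpw
    exact hwv (hdis w (H₁.inc_subset g (h g hg) hwg) hw₂)
  · obtain ⟨g, hg, hug⟩ := p.exists_mem_edges_of_mem_anchors hne hpu
    exact huv (hdis u hu₁ (H₂.inc_subset g (h g hg) hug))

end Separating

end MultiHypergraph

theorem mainTheorem10 {V : Type*} {E : Type*} [Finite V] [Nonempty V] [Finite E]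
    (H : MultiHypergraph V E) (hconn : H.Connected) (hE : 2 ≤ Nat.card E)
    (hsize : ∀ e : E, 2 ≤ H.edgeCard e) (hdeg : ∀ v : V, 2 ≤ H.degree v) :
    List.TFAE [
      ¬ ∃ v : V, H.IsSeparatingVertex v,
      ∀ x y : V ⊕ E, x ≠ y → H.OnCommonPseudoCycle x y,
      ∀ e f : E, e ≠ f → H.OnCommonPseudoCycle (Sum.inr e) (Sum.inr f),
      ∀ u v : V, u ≠ v → H.OnCommonPseudoCycle (Sum.inl u) (Sum.inl v)] := by
  tfae_have 1 → 2 := fun h x y hxy =>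
    (MultiHypergraph.linked_of_not_separating hconn hsize hdeg h x y).onCommonPseudoCycle hxy
  tfae_have 2 → 3 := fun h e f hef => h _ _ (by simpa using hef)
  tfae_have 2 → 4 := fun h u v huv => h _ _ (by simpa using huv)
  tfae_have 3 → 1 := by
    rintro h ⟨v, hv⟩
    obtain ⟨e, f, hef, hn⟩ := hv.exists_edges
    exact hn (h e f hef)
  tfae_have 4 → 1 := by
    rintro h ⟨v, hv⟩
    obtain ⟨u, w, huw, hn⟩ := hv.exists_verts hsize
    exact hn (h u w huw)
  tfae_finish
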